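/- Let $a>0$, $\gamma\ge 1$, $\rho_s>0$, $\mu>0$, $\kappa>0$ be real constants. Let $\mathcal O_2\subseteq(0,\pi)$ be any open set (possibly all of $(0,\pi)$) and let $T>0$. Consider $$\begin{cases}\partial_t\rho+\rho_s\,\partial_xu=0,\\ \partial_tu+a\gamma\rho_s^{\gamma-2}\,\partial_x\rho-\frac1{\rho_s}\,\partial_xS=\mathbb 1_{\mathcal O_2}f_2,\\ \partial_tS+\frac1\kappa S-\frac\mu\kappa\,\partial_xu=0\end{cases}\qquad\text{in }(0,T)\times(0,\pi),$$ with $u(t,0)=u(t,\pi)=0$ for $t\in(0,T)$ and $(\rho,u,S)(0)=(\rho_0,u_0,S_0)$; solutions are the weak (equivalently, mild) solutions in $C([0,T];L^2(0,\pi)^3)$. Let $L^2_m(0,\pi)=\{f\in L^2(0,\pi):\int_0^\pi f\,dx=0\}$. Then the system is not null controllable at time $T$ in $L^2_m(0,\pi)\times L^2(0,\pi)\times L^2_m(0,\pi)$ by a velocity control; that is, there is an initial datum $(\rho_0,u_0,S_0)\in L^2_m(0,\pi)\times L^2(0,\pi)\times L^2_m(0,\pi)$ such that for no $f_2\in L^2(0,T;L^2(0,\pi))$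 does the corresponding solution satisfy $(\rho,u,S)(T)=0$. This holds both for real-valued and for complex-valued functions. -/

import Mathlib

open MeasureTheory Set

open scoped ContDiff

noncomputable section

namespace MaxwellNS

/-- The physical constants: pressure law `p(ρ) = a ρ ^ γ` with `a > 0`, `γ ≥ 1`, the constant
background density `ρs > 0`, the viscosity `μ > 0` and the relaxation time `κ > 0`. -/
structure Params where
  a : ℝ
  γ : ℝ
  ρs : ℝ
  μ : ℝ
  κ : ℝ
  a_pos : 0 < a
  one_le_γ : 1 ≤ γ
  ρs_pos : 0 < ρs
  μ_pos : 0 < μ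
  κ_pos : 0 < κ

/-- The constant `b = a γ ρs ^ (γ - 2)`. -/
def Params.b (P : Params) : ℝ := P.a * P.γ * P.ρs ^ (P.γ - 2)

/-- Lebesgue measure on the interval `(0, π)`. -/
abbrev vol : Measure ℝ := volume.restrict (Ioo 0 Real.pi)

/-- The space `L²(0, π)` with values in `𝕜` (real or complex). -/
abbrev L2 (𝕜 : Type*) [RCLike 𝕜] : Type _ := Lp 𝕜 2 vol

/-- The state space `L²(0, π) × L²(0, π) × L²(0, π)`; a state is a triple `(ρ, u, S)`
(density, velocity, stress). -/
abbrev State (𝕜 : Type*) [RCLike 𝕜] : Type _ := L2 𝕜 × L2 𝕜 × L2 𝕜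

/-- The space `L²(0, T; L²(0, π))` of controls. -/
abbrev Control (𝕜 : Type*) [RCLike 𝕜] (T : ℝ) : Type _ :=
  Lp (L2 𝕜) 2 (volume.restrict (Ioo 0 T))

variable {𝕜 : Type*} [RCLike 𝕜]

/-- `g ∈ L²(0, π)` is the weak derivative of `f ∈ L²(0, π)` on `(0, π)`. Thus `f ∈ H¹(0, π)` means
that such a `g` exists. -/
def HasWeakDeriv (f g : L2 𝕜) : Prop :=
  ∀ η : ℝ → ℝ, ContDiff ℝ ∞ η → HasCompactSupport η → tsupport η ⊆ Ioo 0 Real.pi →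
    ∫ x, deriv η x • f x ∂vol = -∫ x, η x • g x ∂vol

/-- Zero Dirichlet boundary values: `f` has a representative that is continuous on `[0, π]` and
vanishes at `0` and at `π`. For `f ∈ H¹(0, π)` this says `f ∈ H¹₀(0, π)`. -/
def VanishesAtEndpoints (f : L2 𝕜) : Prop :=
  ∃ w : ℝ → 𝕜, ContinuousOn w (Icc 0 Real.pi) ∧ f =ᵐ[vol] w ∧ w 0 = 0 ∧ w Real.pi = 0

/-- The weighted inner product
`b ∫ ρ conj σ + ρs ∫ u conj v + (κ / μ) ∫ S conj R` of `(ρ, u, S)` and `(σ, v, R)`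
(Mathlib's `inner` is conjugate-linear in its first argument). -/
def pairing (P : Params) (z φ : State 𝕜) : 𝕜 :=
  (P.b : 𝕜) * inner 𝕜 φ.1 z.1 + (P.ρs : 𝕜) * inner 𝕜 φ.2.1 z.2.1
    + ((P.κ / P.μ : ℝ) : 𝕜) * inner 𝕜 φ.2.2 z.2.2

/-- The graph of the adjoint `A*`, with respect to `pairing`, of the operator
`A (ρ, u, S) = (-ρs u', -b ρ' + S' / ρs, (μ / κ) u' - S / κ)` with domain
`{u ∈ H¹₀, -b ρ + S / ρs ∈ H¹}`. The triple `φ = (σ, v, R)` is in the domain of `A*` when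
`v ∈ H¹₀` and `b σ - R / ρs ∈ H¹`, and then
`A* φ = (ρs v', (b σ - R / ρs)', -(μ / κ) v' - R / κ)`. -/
def AdjointGraph (P : Params) (φ ψ : State 𝕜) : Prop :=
  ∃ dv dq : L2 𝕜,
    HasWeakDeriv φ.2.1 dv ∧ VanishesAtEndpoints φ.2.1 ∧
    HasWeakDeriv ((P.b : 𝕜) • φ.1 - ((1 / P.ρs : ℝ) : 𝕜) • φ.2.2) dq ∧
    ψ = ((P.ρs : 𝕜) • dv, dq,
      -((P.μ / P.κ : ℝ) : 𝕜) • dv - ((1 / P.κ : ℝ) : 𝕜) • φ.2.2)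

/-- The pairing of the velocity forcing `(0, 1_O g, 0)` with the test triple `φ`. -/
def forcing (P : Params) (O : Set ℝ) (g : L2 𝕜) (φ : State 𝕜) : 𝕜 :=
  (P.ρs : 𝕜) * ∫ x in O, g x * (starRingEnd 𝕜) (φ.2.1 x) ∂vol

/-- `z = (ρ, u, S) ∈ C([0, T]; L²(0, π)³)` is the (weak, equivalently mild) solution of
`∂ₜρ + ρs ∂ₓu = 0`,
`∂ₜu + a γ ρs ^ (γ - 2) ∂ₓρ - (1 / ρs) ∂ₓS = 1_O f`,
`∂ₜS + S / κ - (μ / κ) ∂ₓu = 0` on `(0, T) × (0, π)`, with `u(t, 0) = u(t, π) = 0` and `z(0) = z₀`: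
for every `φ` in the domain of `A*` and every `t ∈ [0, T]`,
`⟨z(t), φ⟩ = ⟨z₀, φ⟩ + ∫₀ᵗ (⟨z(s), A* φ⟩ + ⟨(0, 1_O f(s), 0), φ⟩) ds`. -/
def IsSolution (P : Params) (T : ℝ) (O : Set ℝ) (z₀ : State 𝕜) (f : Control 𝕜 T)
    (z : ℝ → State 𝕜) : Prop :=
  ContinuousOn z (Icc 0 T) ∧
  ∀ φ ψ : State 𝕜, AdjointGraph P φ ψ → ∀ t ∈ Icc 0 T,
    pairing P (z t) φ =
      pairing P z₀ φ + ∫ s in (0 : ℝ)..t, (pairing P (z s) ψ + forcing P O (f s) φ)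

/-- Null controllability at time `T`, for initial data in `X`, by velocity controls in
`L²(0, T; L²(0, π))` acting on `O` only. -/
def NullControllable (P : Params) (T : ℝ) (O : Set ℝ) (X : Set (State 𝕜)) : Prop :=
  ∀ z₀ ∈ X, ∃ f : Control 𝕜 T, ∃ z : ℝ → State 𝕜, IsSolution P T O z₀ f z ∧ z T = 0

/-- The space `L²ₘ(0, π) × L²(0, π) × L²ₘ(0, π)`: density and stress have zero mean. -/
def zeroMeanStates (𝕜 : Type*) [RCLike 𝕜] : Set (State 𝕜) :=
  {z | ∫ x, z.1 x ∂vol = 0 ∧ ∫ x, z.2.2 x ∂vol = 0}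

end MaxwellNS

end

open MeasureTheory Set
open scoped ContDiff

noncomputable section

namespace MaxwellNS

variable {𝕜 : Type*} [RCLike 𝕜]

/-! The obstruction is a branch of adjoint eigenvectors `(cos nx, β sin nx, d cos nx)` whose real
eigenvalues stay in `(-1/κ, 0)`, so that `β = l / (ρs n)` is `O(1/n)`: a velocity control hardly
sees them, while their density part keeps norm `√(π/2)`. Paired with such an eigenvector, a solution
satisfies a scalar linear equation. If it vanishes at `T`, Duhamel bounds the initial pairing by `‖β
sin nx‖` times the `L¹` norm of the control, uniformly in `n` (`norm_pairing_le_of_isSolution`).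
Null controllability would thus force the cosine coefficients of every `L²` density to be `O(1/n)`,
which the uniform boundedness principle forbids. -/

instance : IsFiniteMeasure vol := ⟨by simp⟩

lemma integral_vol {E : Type*} [NormedAddCommGroup E] [NormedSpace ℝ E] (f : ℝ → E) :
    ∫ x, f x ∂vol = ∫ x in (0 : ℝ)..Real.pi, f x := by
  rw [intervalIntegral.integral_of_le Real.pi_pos.le, integral_Ioc_eq_integral_Ioo]

/-! ### Continuous functions as elements of `L²` -/

variable (𝕜) in
lemma memLp_continuousMap (f : C(ℝ, ℝ)) : MemLp (fun x => (f x : 𝕜)) 2 vol := by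
  obtain ⟨C, hC⟩ := (isCompact_Icc (a := (0 : ℝ)) (b := Real.pi)).exists_bound_of_continuousOn
    f.continuous.continuousOn
  refine MemLp.of_bound (RCLike.continuous_ofReal.comp f.continuous).aestronglyMeasurable C ?_
  refine (ae_restrict_iff' measurableSet_Ioo).2 (.of_forall fun x hx => ?_)
  simpa using hC x (Ioo_subset_Icc_self hx)

variable (𝕜) in
/-- The class in `L²(0, π)` of a continuous real function. -/
def ofContinuous (f : C(ℝ, ℝ)) : L2 𝕜 := (memLp_continuousMap 𝕜 f).toLp _

lemma coeFn_ofContinuous (f : C(ℝ, ℝ)) : ofContinuous 𝕜 f =ᵐ[vol] fun x => (f x : 𝕜) :=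
  MemLp.coeFn_toLp _

lemma inner_ofContinuous (f g : C(ℝ, ℝ)) :
    inner 𝕜 (ofContinuous 𝕜 f) (ofContinuous 𝕜 g)
      = ((∫ x in (0 : ℝ)..Real.pi, f x * g x : ℝ) : 𝕜) := by
  rw [L2.inner_def, ← integral_vol, ← integral_ofReal]
  refine integral_congr_ae ?_
  filter_upwards [coeFn_ofContinuous (𝕜 := 𝕜) f, coeFn_ofContinuous (𝕜 := 𝕜) g] with x hf hg
  simp [hf, hg, mul_comm]

lemma inner_ofContinuous_one (f : L2 𝕜) : inner 𝕜 (ofContinuous 𝕜 1) f = ∫ x, f x ∂vol := by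
  rw [L2.inner_def]
  refine integral_congr_ae ?_
  filter_upwards [coeFn_ofContinuous (𝕜 := 𝕜) 1] with x hx
  simp [hx]

lemma norm_ofContinuous_sq (f : C(ℝ, ℝ)) :
    ‖ofContinuous 𝕜 f‖ ^ 2 = ∫ x in (0 : ℝ)..Real.pi, f x ^ 2 := by
  have h := inner_self_eq_norm_sq_to_K (𝕜 := 𝕜) (ofContinuous 𝕜 f)
  rw [inner_ofContinuous] at h
  have h' : ∫ x in (0 : ℝ)..Real.pi, f x * f x = ‖ofContinuous 𝕜 f‖ ^ 2 := by exact_mod_cast h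
  rw [← h']
  simp_rw [pow_two]

/-! ### Weak derivatives -/

lemma HasWeakDeriv.const_smul {f g : L2 𝕜} (h : HasWeakDeriv f g) (c : 𝕜) :
    HasWeakDeriv (c • f) (c • g) := by
  intro η hη hc hs
  have key : ∀ (θ : ℝ → ℝ) (k : L2 𝕜),
      ∫ x, θ x • (c • k : L2 𝕜) x ∂vol = c * ∫ x, θ x • k x ∂vol := by
    intro θ k
    rw [← integral_const_mul]
    refine integral_congr_ae ?_
    filter_upwards [Lp.coeFn_smul c k] with x hx
    rw [hx, Pi.smul_apply, smul_eq_mul, mul_smul_comm]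
  rw [key, key, h η hη hc hs, mul_neg]

lemma hasWeakDeriv_ofContinuous {f g : C(ℝ, ℝ)} (h : ∀ x, HasDerivAt f (g x) x) :
    HasWeakDeriv (ofContinuous 𝕜 f) (ofContinuous 𝕜 g) := by
  intro η hη hc hs
  have key : ∀ (θ : ℝ → ℝ) (k : C(ℝ, ℝ)), ∫ x, θ x • (ofContinuous 𝕜 k) x ∂vol
      = ((∫ x in (0 : ℝ)..Real.pi, θ x * k x : ℝ) : 𝕜) := by
    intro θ k
    rw [← integral_vol, ← integral_ofReal]
    refine integral_congr_ae ?_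
    filter_upwards [coeFn_ofContinuous (𝕜 := 𝕜) k] with x hx
    simp [hx, RCLike.real_smul_eq_coe_mul]
  have h0 : η 0 = 0 := image_eq_zero_of_notMem_tsupport fun hx => (hs hx).1.false
  have hpi : η Real.pi = 0 := image_eq_zero_of_notMem_tsupport fun hx => (hs hx).2.false
  have ibp := intervalIntegral.integral_mul_deriv_eq_deriv_mul (a := 0) (b := Real.pi)
    (fun x _ => ((hη.differentiable (by simp)) x).hasDerivAt) (fun x _ => h x)
    ((hη.continuous_deriv (by simp)).intervalIntegrable _ _)
    (g.continuous.intervalIntegrable _ _)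
  rw [h0, hpi, zero_mul, zero_mul, sub_zero, zero_sub] at ibp
  rw [key, key, ibp]
  simp

/-! ### Trigonometric modes -/

/-- The function `x ↦ cos (n x)`. -/
def cosMode (n : ℕ) : C(ℝ, ℝ) := ⟨fun x => Real.cos (n * x), by fun_prop⟩

/-- The function `x ↦ sin (n x)`. -/
def sinMode (n : ℕ) : C(ℝ, ℝ) := ⟨fun x => Real.sin (n * x), by fun_prop⟩

lemma hasWeakDeriv_sinMode (n : ℕ) :
    HasWeakDeriv (ofContinuous 𝕜 (sinMode n)) ((n : 𝕜) • ofContinuous 𝕜 (cosMode n)) := by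
  have e : (n : 𝕜) • ofContinuous 𝕜 (cosMode n) = ofContinuous 𝕜 ((n : ℝ) • cosMode n) := by
    refine Lp.ext ?_
    filter_upwards [Lp.coeFn_smul (n : 𝕜) (ofContinuous 𝕜 (cosMode n)),
      coeFn_ofContinuous (𝕜 := 𝕜) (cosMode n),
      coeFn_ofContinuous (𝕜 := 𝕜) ((n : ℝ) • cosMode n)] with x h1 h2 h3
    rw [h1, h3, Pi.smul_apply, h2]
    simp
  rw [e]
  refine hasWeakDeriv_ofContinuous fun x => ?_
  have := ((hasDerivAt_id x).const_mul (n : ℝ)).sin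
  simpa [sinMode, cosMode, mul_comm] using this

lemma hasWeakDeriv_cosMode (n : ℕ) :
    HasWeakDeriv (ofContinuous 𝕜 (cosMode n)) ((-n : 𝕜) • ofContinuous 𝕜 (sinMode n)) := by
  have e : (-n : 𝕜) • ofContinuous 𝕜 (sinMode n) = ofContinuous 𝕜 ((-n : ℝ) • sinMode n) := by
    refine Lp.ext ?_
    filter_upwards [Lp.coeFn_smul (-n : 𝕜) (ofContinuous 𝕜 (sinMode n)),
      coeFn_ofContinuous (𝕜 := 𝕜) (sinMode n),
      coeFn_ofContinuous (𝕜 := 𝕜) ((-n : ℝ) • sinMode n)] with x h1 h2 h3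
    rw [h1, h3, Pi.smul_apply, h2]
    simp
  rw [e]
  refine hasWeakDeriv_ofContinuous fun x => ?_
  have := ((hasDerivAt_id x).const_mul (n : ℝ)).cos
  simpa [sinMode, cosMode, mul_comm] using this

lemma vanishesAtEndpoints_sinMode (n : ℕ) (c : 𝕜) :
    VanishesAtEndpoints (c • ofContinuous 𝕜 (sinMode n)) := by
  refine ⟨fun x => c * (sinMode n x : 𝕜), ?_, ?_, ?_, ?_⟩
  · exact (continuous_const.mul
      (RCLike.continuous_ofReal.comp (sinMode n).continuous)).continuousOn
  · filter_upwards [Lp.coeFn_smul c (ofContinuous 𝕜 (sinMode n)),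
      coeFn_ofContinuous (𝕜 := 𝕜) (sinMode n)] with x h1 h2
    rw [h1, Pi.smul_apply, h2, smul_eq_mul]
  · simp [sinMode]
  · simp [sinMode, Real.sin_nat_mul_pi]

lemma norm_cosMode_sq {n : ℕ} (hn : n ≠ 0) :
    ‖ofContinuous 𝕜 (cosMode n)‖ ^ 2 = Real.pi / 2 := by
  have hn' : (n : ℝ) ≠ 0 := by exact_mod_cast hn
  rw [norm_ofContinuous_sq]
  have := intervalIntegral.integral_comp_mul_left (a := 0) (b := Real.pi)
    (fun x => Real.cos x ^ 2) hn'
  simp only [cosMode, ContinuousMap.coe_mk]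
  rw [this, integral_cos_sq]
  simp [Real.sin_nat_mul_pi]
  field_simp

lemma norm_sinMode_le (n : ℕ) : ‖ofContinuous 𝕜 (sinMode n)‖ ≤ Real.pi := by
  refine abs_le_of_sq_le_sq' (a := ‖ofContinuous 𝕜 (sinMode n)‖) ?_ Real.pi_pos.le |>.2
  rw [norm_ofContinuous_sq]
  have : ∫ x in (0 : ℝ)..Real.pi, sinMode n x ^ 2 ≤ ∫ x in (0 : ℝ)..Real.pi, (1 : ℝ) :=
    intervalIntegral.integral_mono_on Real.pi_pos.le
      (((sinMode n).continuous.pow 2).intervalIntegrable _ _) (by simp)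
      fun x _ => Real.sin_sq_le_one _
  simp only [intervalIntegral.integral_const, sub_zero, smul_eq_mul, mul_one] at this
  nlinarith [Real.pi_gt_three]

/-- Subtracting its mean from a density leaves the cosine coefficients with `n ≠ 0` unchanged. -/
lemma inner_cosMode_one {n : ℕ} (hn : n ≠ 0) :
    inner 𝕜 (ofContinuous 𝕜 (cosMode n)) (ofContinuous 𝕜 1) = 0 := by
  have hn' : (n : ℝ) ≠ 0 := by exact_mod_cast hn
  rw [inner_ofContinuous]
  have := intervalIntegral.integral_comp_mul_left (a := 0) (b := Real.pi) Real.cos hn'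
  simp [cosMode, this, Real.sin_nat_mul_pi]

/-! ### Eigenvectors of the adjoint operator -/

lemma Params.b_pos (P : Params) : 0 < P.b :=
  mul_pos (mul_pos P.a_pos (zero_lt_one.trans_le P.one_le_γ)) (Real.rpow_pos_of_pos P.ρs_pos _)

/-- The characteristic polynomial of the adjoint on the `n`-th mode has a root in `(-1 / κ, 0)`. -/
lemma exists_eigenvalue (P : Params) {n : ℕ} (hn : n ≠ 0) :
    ∃ l : ℝ, -(1 / P.κ) < l ∧ l < 0 ∧
      l ^ 2 * (l + 1 / P.κ) + (n : ℝ) ^ 2 * (P.b * P.ρs * (l + 1 / P.κ) + P.μ / (P.κ * P.ρs) * l)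
        = 0 := by
  have hb := P.b_pos
  have hr := P.ρs_pos
  have hm := P.μ_pos
  have hk := P.κ_pos
  have hn' : (0 : ℝ) < n := by exact_mod_cast Nat.pos_of_ne_zero hn
  set p : ℝ → ℝ := fun l => l ^ 2 * (l + 1 / P.κ)
    + (n : ℝ) ^ 2 * (P.b * P.ρs * (l + 1 / P.κ) + P.μ / (P.κ * P.ρs) * l) with hp
  have hc : Continuous p := by fun_prop
  have h0 : 0 < p 0 := by simp only [hp]; simp; positivity
  -- The factor `l + 1/κ` vanishes here, so only the `μ` term survives.
  have h1 : p (-(1 / P.κ)) < 0 := by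
    have : p (-(1 / P.κ)) = -((n : ℝ) ^ 2 * (P.μ / (P.κ * P.ρs) * (1 / P.κ))) := by
      simp only [hp]; ring
    rw [this]
    exact neg_neg_of_pos (by positivity)
  obtain ⟨l, hl, hl0⟩ := intermediate_value_Ioo (neg_nonpos.2 (one_div_pos.2 hk).le)
    hc.continuousOn ⟨h1, h0⟩
  exact ⟨l, hl.1, hl.2, hl0⟩

/-- On a fixed mode the eigenvalue problem is a 3×3 system: the first row gives the coefficient of
`sin`, the third gives `d`, and the second is then the characteristic equation. -/
lemma exists_eigenvector (𝕜 : Type*) [RCLike 𝕜] (P : Params) {n : ℕ} (hn : n ≠ 0) :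
    ∃ l d : ℝ, |l| ≤ 1 / P.κ ∧
      AdjointGraph P
        (ofContinuous 𝕜 (cosMode n), ((l / (P.ρs * n) : ℝ) : 𝕜) • ofContinuous 𝕜 (sinMode n),
          (d : 𝕜) • ofContinuous 𝕜 (cosMode n))
        ((l : 𝕜) • (ofContinuous 𝕜 (cosMode n),
          ((l / (P.ρs * n) : ℝ) : 𝕜) • ofContinuous 𝕜 (sinMode n),
          (d : 𝕜) • ofContinuous 𝕜 (cosMode n))) := by
  obtain ⟨l, hl, hl0, hroot⟩ := exists_eigenvalue P hn
  have hr := P.ρs_pos.ne'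
  have hk := P.κ_pos.ne'
  have hn' : (n : ℝ) ≠ 0 := by exact_mod_cast hn
  have hlk : l + 1 / P.κ ≠ 0 := by linarith
  set d : ℝ := -(P.μ / P.κ * (l / P.ρs)) / (l + 1 / P.κ)
  have hdl : d * (l + 1 / P.κ) = -(P.μ / P.κ * (l / P.ρs)) := div_mul_cancel₀ _ hlk
  set β : ℝ := l / (P.ρs * n) with hβ
  have h1 : P.ρs * (β * n) = l := by rw [hβ]; field_simp
  have h2 : (P.b - 1 / P.ρs * d) * -n = l * β := by
    -- Clearing the denominator of `d` turns the second row into `-1 / (ρs n)` times the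
    -- characteristic polynomial.
    have : ((P.b - 1 / P.ρs * d) * -n - l * β) * (l + 1 / P.κ) = 0 := by
      have e : ((P.b - 1 / P.ρs * d) * -n - l * β) * (l + 1 / P.κ)
          = -n * P.b * (l + 1 / P.κ) + n / P.ρs * (d * (l + 1 / P.κ))
            - l * β * (l + 1 / P.κ) := by ring
      rw [e, hdl, hβ]
      have e2 : -n * P.b * (l + 1 / P.κ) + n / P.ρs * (-(P.μ / P.κ * (l / P.ρs)))
            - l * (l / (P.ρs * n)) * (l + 1 / P.κ)
          = -(1 / (P.ρs * n)) * (l ^ 2 * (l + 1 / P.κ)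
            + (n : ℝ) ^ 2 * (P.b * P.ρs * (l + 1 / P.κ) + P.μ / (P.κ * P.ρs) * l)) := by
        field_simp
        ring
      rw [e2, hroot, mul_zero]
    linarith [(mul_eq_zero.1 this).resolve_right hlk]
  have h3 : -(P.μ / P.κ) * (β * n) - 1 / P.κ * d = l * d := by
    have : β * n = l / P.ρs := by rw [hβ]; field_simp
    rw [this]
    linarith
  refine ⟨l, d, abs_le.2 ⟨hl.le, hl0.le.trans (one_div_pos.2 P.κ_pos).le⟩,
    (β : 𝕜) • (n : 𝕜) • ofContinuous 𝕜 (cosMode n),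
    ((P.b - 1 / P.ρs * d : ℝ) : 𝕜) • (-n : 𝕜) • ofContinuous 𝕜 (sinMode n),
    (hasWeakDeriv_sinMode n).const_smul _, vanishesAtEndpoints_sinMode n _, ?_, ?_⟩
  · have e : (P.b : 𝕜) • ofContinuous 𝕜 (cosMode n)
        - ((1 / P.ρs : ℝ) : 𝕜) • (d : 𝕜) • ofContinuous 𝕜 (cosMode n)
        = ((P.b - 1 / P.ρs * d : ℝ) : 𝕜) • ofContinuous 𝕜 (cosMode n) := by
      rw [smul_smul, ← sub_smul]
      push_cast
      rfl
    simp only [e]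
    exact (hasWeakDeriv_cosMode n).const_smul _
  · have h1' : (P.ρs : 𝕜) * (β * n) = l := by exact_mod_cast congrArg (RCLike.ofReal (K := 𝕜)) h1
    have h2' : ((P.b - 1 / P.ρs * d : ℝ) : 𝕜) * -n = l * β := by
      exact_mod_cast congrArg (RCLike.ofReal (K := 𝕜)) h2
    have h3' : -((P.μ / P.κ : ℝ) : 𝕜) * (β * n) - ((1 / P.κ : ℝ) : 𝕜) * d = l * d := by
      exact_mod_cast congrArg (RCLike.ofReal (K := 𝕜)) h3
    simp only [← hβ, Prod.smul_mk, smul_smul, ← sub_smul, h1', h2', h3']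

/-! ### A scalar Duhamel estimate -/

/-- Since `g` is merely integrable, `y` need not be differentiable. Splitting off its primitive `G`
leaves a differentiable `h` with `h' = l (h + G)`, and the integrating factor `exp (-l t)` removes
the `h` term. -/
lemma norm_initial_le_of_integral_equation {T l K : ℝ} (hT : 0 < T) (hl : |l| ≤ K)
    {y g : ℝ → 𝕜} {y₀ : 𝕜} (hy : ContinuousOn y (Icc 0 T)) (hg : IntervalIntegrable g volume 0 T)
    (heq : ∀ t ∈ Icc 0 T, y t = y₀ + ∫ s in (0 : ℝ)..t, ((l : 𝕜) * y s + g s)) (hyT : y T = 0) :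
    ‖y₀‖ ≤ Real.exp (K * T) * (1 + K * T) * ∫ s in (0 : ℝ)..T, ‖g s‖ := by
  have hK : 0 ≤ K := (abs_nonneg l).trans hl
  set M := ∫ s in (0 : ℝ)..T, ‖g s‖
  set G : ℝ → 𝕜 := fun t => ∫ s in (0 : ℝ)..t, g s with hG
  set h : ℝ → 𝕜 := fun t => y₀ + ∫ s in (0 : ℝ)..t, (l : 𝕜) * y s with hh
  have hyI : ∀ t ∈ Icc 0 T, IntervalIntegrable (fun s => (l : 𝕜) * y s) volume 0 t := by
    intro t ht
    refine ContinuousOn.intervalIntegrable ?_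
    rw [uIcc_of_le ht.1]
    exact (continuousOn_const.mul hy).mono (Icc_subset_Icc_right ht.2)
  have hgI : ∀ t ∈ Icc 0 T, IntervalIntegrable g volume 0 t := fun t ht =>
    hg.mono_set (by rw [uIcc_of_le ht.1, uIcc_of_le hT.le]; exact Icc_subset_Icc_right ht.2)
  have hyh : ∀ t ∈ Icc 0 T, y t = h t + G t := by
    intro t ht
    rw [heq t ht, intervalIntegral.integral_add (hyI t ht) (hgI t ht), ← add_assoc]
  have hGM : ∀ t ∈ Icc 0 T, ‖G t‖ ≤ M := by
    intro t ht
    refine (intervalIntegral.norm_integral_le_integral_norm ht.1).trans ?_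
    exact intervalIntegral.integral_mono_interval le_rfl ht.1 ht.2
      (.of_forall fun _ => norm_nonneg _) hg.norm
  have hexp : ∀ t ∈ Icc 0 T, Real.exp (-l * t) ≤ Real.exp (K * T) := by
    intro t ht
    refine Real.exp_le_exp.2 ?_
    calc -l * t ≤ K * t := mul_le_mul_of_nonneg_right (by linarith [neg_abs_le l]) ht.1
      _ ≤ K * T := mul_le_mul_of_nonneg_left ht.2 hK
  have hder : ∀ t ∈ Icc 0 T, HasDerivWithinAt h ((l : 𝕜) * y t) (Icc 0 T) t := by
    intro t ht
    have hc : ContinuousOn (fun s => (l : 𝕜) * y s) (Icc 0 T) := continuousOn_const.mul hy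
    have : Fact (t ∈ Icc 0 T) := ⟨ht⟩
    exact (intervalIntegral.integral_hasDerivWithinAt_right (hyI t ht)
      (hc.stronglyMeasurableAtFilter_nhdsWithin measurableSet_Icc t) (hc t ht)).const_add y₀
  have hqder : ∀ t ∈ Icc 0 T, HasDerivWithinAt (fun t => Real.exp (-l * t) • h t)
      (Real.exp (-l * t) • ((l : 𝕜) * G t)) (Icc 0 T) t := by
    intro t ht
    have e : HasDerivAt (fun t => Real.exp (-l * t)) (Real.exp (-l * t) * -l) t := by
      simpa using ((hasDerivAt_id t).const_mul (-l)).exp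
    refine (e.hasDerivWithinAt.smul (hder t ht)).congr_deriv ?_
    rw [hyh t ht]
    simp only [RCLike.real_smul_eq_coe_mul]
    push_cast
    ring
  have hT' : T ∈ Icc 0 T := ⟨hT.le, le_rfl⟩
  have hM : 0 ≤ M := (norm_nonneg _).trans (hGM T hT')
  have key := norm_image_sub_le_of_norm_deriv_le_segment' hqder
    (C := Real.exp (K * T) * (K * M)) (fun t ht => by
      have ht' := Ico_subset_Icc_self ht
      rw [norm_smul, norm_mul, Real.norm_of_nonneg (Real.exp_pos _).le, RCLike.norm_ofReal]
      exact mul_le_mul (hexp t ht') (mul_le_mul hl (hGM t ht') (norm_nonneg _) hK)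
        (by positivity) (Real.exp_pos _).le) T hT'
  have hhT : h T = -G T := by
    have := hyh T hT'
    rw [hyT] at this
    exact eq_neg_of_add_eq_zero_left this.symm
  have h0 : h 0 = y₀ := by simp [hh]
  simp only [mul_zero, Real.exp_zero, one_smul, h0, hhT, sub_zero] at key
  have hqT : ‖Real.exp (-l * T) • -G T‖ ≤ Real.exp (K * T) * M := by
    rw [norm_smul, norm_neg, Real.norm_of_nonneg (Real.exp_pos _).le]
    exact mul_le_mul (hexp T hT') (hGM T hT') (norm_nonneg _) (Real.exp_pos _).le
  calc ‖y₀‖ ≤ ‖Real.exp (-l * T) • -G T‖ + ‖Real.exp (-l * T) • -G T - y₀‖ := by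
        exact norm_le_norm_add_norm_sub _ _
    _ ≤ Real.exp (K * T) * M + Real.exp (K * T) * (K * M) * T := add_le_add hqT key
    _ = _ := by ring

/-! ### The forcing term -/

/-- The indicator moves onto the velocity of the test state, which does not increase its norm. -/
lemma exists_forcing_eq_inner (P : Params) {O : Set ℝ} (hO : MeasurableSet O) (φ : State 𝕜) :
    ∃ w : L2 𝕜, ‖w‖ ≤ ‖φ.2.1‖ ∧ ∀ g : L2 𝕜, forcing P O g φ = (P.ρs : 𝕜) * inner 𝕜 w g := by
  have hw : MemLp (O.indicator φ.2.1) 2 vol := (Lp.memLp φ.2.1).indicator hO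
  refine ⟨hw.toLp _, ?_, fun g => ?_⟩
  · rw [Lp.norm_toLp, Lp.norm_def]
    exact ENNReal.toReal_mono (Lp.eLpNorm_ne_top _) (eLpNorm_indicator_le _)
  · rw [forcing, L2.inner_def, ← integral_indicator hO]
    congr 1
    refine integral_congr_ae ?_
    filter_upwards [hw.coeFn_toLp] with x hx
    rw [hx]
    by_cases hxO : x ∈ O <;> simp [hxO]

/-- An initial state that can be steered to zero pairs with an eigenvector of the adjoint at most
like the velocity component of this eigenvector. -/
lemma norm_pairing_le_of_isSolution (P : Params) {T : ℝ} (hT : 0 < T) {O : Set ℝ}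
    (hO : MeasurableSet O) {z₀ : State 𝕜} {f : Control 𝕜 T} {z : ℝ → State 𝕜}
    (hz : IsSolution P T O z₀ f z) (hzT : z T = 0) {l K : ℝ} (hl : |l| ≤ K) {φ : State 𝕜}
    (hφ : AdjointGraph P φ ((l : 𝕜) • φ)) :
    ‖pairing P z₀ φ‖ ≤ Real.exp (K * T) * (1 + K * T)
      * (P.ρs * ‖φ.2.1‖ * ∫ s in (0 : ℝ)..T, ‖f s‖) := by
  obtain ⟨w, hw, hforce⟩ := exists_forcing_eq_inner P hO φ
  have hK : 0 ≤ K := (abs_nonneg l).trans hl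
  have hfI : IntervalIntegrable f volume 0 T := by
    rw [intervalIntegrable_iff_integrableOn_Ioo_of_le hT.le]
    exact (Lp.memLp f).integrable (by norm_num)
  have hg : IntervalIntegrable (fun s => forcing P O (f s) φ) volume 0 T := by
    simp only [hforce]
    rw [intervalIntegrable_iff] at hfI ⊢
    exact ((innerSL 𝕜 w).integrable_comp hfI).const_mul _
  have hpair : ∀ s, pairing P (z s) ((l : 𝕜) • φ) = (l : 𝕜) * pairing P (z s) φ := by
    intro s
    simp only [pairing, Prod.smul_fst, Prod.smul_snd, inner_smul_left, RCLike.conj_ofReal]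
    ring
  have hy : ContinuousOn (fun t => pairing P (z t) φ) (Icc 0 T) := by
    have hz1 := hz.1
    unfold pairing
    exact ((continuousOn_const.mul (continuousOn_const.inner hz1.fst)).add
      (continuousOn_const.mul (continuousOn_const.inner hz1.snd.fst))).add
      (continuousOn_const.mul (continuousOn_const.inner hz1.snd.snd))
  refine (norm_initial_le_of_integral_equation hT hl hy hg (fun t ht => ?_) ?_).trans ?_
  · simpa only [hpair] using hz.2 φ _ hφ t ht
  · simp [hzT, pairing]
  · refine mul_le_mul_of_nonneg_left ?_ (by positivity)
    rw [← intervalIntegral.integral_const_mul]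
    refine intervalIntegral.integral_mono_on hT.le hg.norm (hfI.norm.const_mul _) fun s _ => ?_
    rw [hforce, norm_mul, RCLike.norm_ofReal, abs_of_pos P.ρs_pos, mul_assoc]
    refine mul_le_mul_of_nonneg_left ?_ P.ρs_pos.le
    exact (norm_inner_le_norm _ _).trans (mul_le_mul_of_nonneg_right hw (norm_nonneg _))

/-- If the system is null controllable, the cosine coefficients of every density are `O(1 / n)`. -/
lemma exists_bound_cosMode_of_nullControllable (P : Params) {T : ℝ} (hT : 0 < T) {O : Set ℝ}
    (hO : MeasurableSet O) (h : NullControllable P T O (zeroMeanStates 𝕜)) (r : L2 𝕜) :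
    ∃ C : ℝ, ∀ n : ℕ, n ≠ 0 → n * ‖inner 𝕜 (ofContinuous 𝕜 (cosMode n)) r‖ ≤ C := by
  set e : L2 𝕜 := ofContinuous 𝕜 1 with he
  have hee : inner 𝕜 e e ≠ 0 := by
    rw [he, inner_ofContinuous]
    simp [Real.pi_ne_zero]
  set c : 𝕜 := inner 𝕜 e r / inner 𝕜 e e with hc
  -- The control is fixed before `n`, so one constant serves all modes.
  obtain ⟨f, z, hz, hzT⟩ := h (r - c • e, 0, 0) <| by
    refine ⟨?_, ?_⟩
    · rw [← inner_ofContinuous_one, inner_sub_right, inner_smul_right, hc, ← he,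
        div_mul_cancel₀ _ hee, sub_self]
    · rw [← inner_ofContinuous_one, inner_zero_right]
  refine ⟨Real.exp (1 / P.κ * T) * (1 + 1 / P.κ * T)
    * (1 / P.κ * Real.pi * ∫ s in (0 : ℝ)..T, ‖f s‖) / P.b, fun n hn => ?_⟩
  obtain ⟨l, d, hl, hφ⟩ := exists_eigenvector 𝕜 P hn
  have key := norm_pairing_le_of_isSolution P hT hO hz hzT hl hφ
  have hn' : (0 : ℝ) < n := by exact_mod_cast Nat.pos_of_ne_zero hn
  have hk := P.κ_pos
  have hr := P.ρs_pos
  have hint : 0 ≤ ∫ s in (0 : ℝ)..T, ‖f s‖ :=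
    intervalIntegral.integral_nonneg hT.le fun _ _ => norm_nonneg _
  have hp : pairing P ((r - c • e, 0, 0) : State 𝕜)
      (ofContinuous 𝕜 (cosMode n), ((l / (P.ρs * n) : ℝ) : 𝕜) • ofContinuous 𝕜 (sinMode n),
          (d : 𝕜) • ofContinuous 𝕜 (cosMode n))
      = (P.b : 𝕜) * inner 𝕜 (ofContinuous 𝕜 (cosMode n)) r := by
    simp [pairing, inner_sub_right, inner_smul_right, he, inner_cosMode_one hn]
  rw [hp, norm_mul, RCLike.norm_ofReal, abs_of_pos P.b_pos] at key
  have hv : P.ρs * ‖((l / (P.ρs * n) : ℝ) : 𝕜) • ofContinuous 𝕜 (sinMode n)‖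
      ≤ 1 / P.κ * Real.pi / n := by
    rw [norm_smul, RCLike.norm_ofReal, abs_div, abs_of_pos (mul_pos hr hn')]
    calc P.ρs * (|l| / (P.ρs * n) * ‖ofContinuous 𝕜 (sinMode n)‖)
        = |l| * ‖ofContinuous 𝕜 (sinMode n)‖ / n := by field_simp
      _ ≤ _ := by
        gcongr
        exact norm_sinMode_le n
  rw [le_div_iff₀ P.b_pos]
  calc n * ‖inner 𝕜 (ofContinuous 𝕜 (cosMode n)) r‖ * P.b
      = n * (P.b * ‖inner 𝕜 (ofContinuous 𝕜 (cosMode n)) r‖) := by ring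
    _ ≤ n * (Real.exp (1 / P.κ * T) * (1 + 1 / P.κ * T)
        * (1 / P.κ * Real.pi / n * ∫ s in (0 : ℝ)..T, ‖f s‖)) := by
      refine mul_le_mul_of_nonneg_left (key.trans ?_) hn'.le
      gcongr
    _ = _ := by field_simp

end MaxwellNS

end

theorem theorem1p2 (𝕜 : Type*) [RCLike 𝕜] (P : MaxwellNS.Params)
    (O₂ : Set ℝ) (hO₂ : IsOpen O₂) (hsub : O₂ ⊆ Ioo 0 Real.pi) (T : ℝ) (hT : 0 < T) :
    ¬ MaxwellNS.NullControllable P T O₂ (MaxwellNS.zeroMeanStates 𝕜) := by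
  intro h
  -- The functionals `n ⟨cos nx, ·⟩` are pointwise bounded; the shift `n = m + 1` skips the constant
  -- mode.
  obtain ⟨C, hC⟩ := banach_steinhaus
    (g := fun m : ℕ => ((m + 1 : ℕ) : 𝕜) •
      innerSL 𝕜 (MaxwellNS.ofContinuous 𝕜 (MaxwellNS.cosMode (m + 1)))) fun r => by
    obtain ⟨C, hC⟩ := MaxwellNS.exists_bound_cosMode_of_nullControllable P hT
      hO₂.measurableSet h r
    refine ⟨C, fun m => ?_⟩
    rw [smul_apply, innerSL_apply_apply, norm_smul, RCLike.norm_natCast]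
    exact hC (m + 1) m.succ_ne_zero
  obtain ⟨m, hm⟩ := exists_nat_gt C
  have h1 := hC m
  rw [norm_smul, RCLike.norm_natCast, innerSL_apply_norm] at h1
  have h2 := MaxwellNS.norm_cosMode_sq (𝕜 := 𝕜) m.succ_ne_zero
  -- As `π / 2 ≥ 1`, the operator norms are at least `m + 1`, hence unbounded.
  have h3 : 1 ≤ ‖MaxwellNS.ofContinuous 𝕜 (MaxwellNS.cosMode (m + 1))‖ := by
    nlinarith [Real.pi_gt_three,
      norm_nonneg (MaxwellNS.ofContinuous 𝕜 (MaxwellNS.cosMode (m + 1)))]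
  have h4 : ((m + 1 : ℕ) : ℝ) ≤ C := (le_mul_of_one_le_right (Nat.cast_nonneg _) h3).trans h1
  push_cast at h4
  linarith
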